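/- The size of a context-free grammar is the total number of symbols on the right-hand sides of its production rules, and the smallest grammar of a string $s$ is a context-free grammar of minimum size among those that generate $s$ and only $s$. The LZD parsing of a string $s$ over an alphabet $\Sigma$ is the factorization $s = p_1 p_2 \cdots p_z$ computed from left to right in which $p_i = uv$, where $u$ is the longest prefix of the part of $s$ after $p_1\cdots p_{i-1}$ that belongs to $\{p_1,\dots,p_{i-1}\}\cup\Sigma$, and $v$ is the longest such prefix of what remains after $u$ ($v$ is empty if nothing remains). The LZMW parsing of $s$ is the factorization $s = p_1 p_2\cdots p_z$ in which $p_i$ is the longest prefix of the part of $s$ after $p_1\cdots p_{i-1}$ that belongs to $\{p_jp_{j+1} : 1\le j\le i-2\}\cup\Sigma$. The corresponding LZD and LZMW grammars have the start rule $S\to p_1p_2\cdots p_z$ and, for each phrase $p_i$, one rule that writes $p_i$ as the concatenation of its two parts, each a letter or an earlier phrase (LZD), respectively as $p_i\to p_jp_{j+1}$ or as a single letter (LZMW). **Theorem.** There are a finite alphabet and a constant $c>0$ such that for arbitrarily large $n$ there is a string $s$ of length $n$ over this alphabet, ending in a letter that occurs nowhere else in $s$, for which both the size of the LZD grammar and the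 size of the LZMW grammar of $s$ are at least $c\,n^{1/3}$ times the size of the smallest grammar of $s$. -/

import Mathlib

/-! ### Grammars and their sizes -/

/-- The size of a context-free grammar: the total number of symbols on the right-hand sides of its
production rules. -/
def ContextFreeGrammar.size {α : Type} (g : ContextFreeGrammar α) : ℕ :=
  ∑ r ∈ g.rules, r.output.length

/-- Every string is generated by some grammar, so the
infimum defining `smallestGrammarSize` is attained. -/
theorem exists_grammar {α : Type} (s : List α) :
    ∃ g : ContextFreeGrammar α, g.language = {s} := by
  refine ⟨⟨Unit, (), {⟨(), s.map Symbol.terminal⟩}⟩, ?_⟩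
  ext w
  simp only [ContextFreeGrammar.mem_language_iff]
  constructor
  · intro h
    rcases h.eq_or_head with h | ⟨v, ⟨r, hr, hv⟩, h⟩
    · cases w <;> simp at h
    · simp only [Finset.mem_singleton] at hr
      subst hr
      cases hv with
      | cons _ h2 => cases h2
      | head _ =>
        rw [List.append_nil] at h
        rcases h.eq_or_head with h | ⟨v, ⟨r, hr, hv⟩, h⟩
        · exact (List.map_injective_iff.2 (fun a b hab => by simpa using hab) h).symm
        · have := hv.nonterminal_input_mem
          simp at this
  · rintro rfl
    refine ContextFreeGrammar.Produces.single ⟨_, Finset.mem_singleton_self _, ?_⟩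
    exact ContextFreeRule.Rewrites.input_output

/-- The size of the smallest context-free grammar that generates the string `s` and only this
string. -/
noncomputable def smallestGrammarSize {α : Type} (s : List α) : ℕ :=
  sInf {m : ℕ | ∃ g : ContextFreeGrammar α, g.language = {s} ∧ g.size = m}

/-! ### Longest matches -/

/-- The longest prefix `w` of `t` such that `w` is a single letter or belongs to the list `D`
(`[]` if there is no such prefix, which for `D` without `[]` happens only when `t = []`).
Note that `List.inits` lists the prefixes by increasing length. -/
def longestMatch {α : Type} [DecidableEq α] (D : List (List α)) (t : List α) : List α :=
  ((t.inits.filter (fun w => w.length = 1 ∨ w ∈ D)).getLast?).getD []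

theorem longestMatch_spec {α : Type} [DecidableEq α] (D : List (List α)) (a : α) (t : List α) :
    longestMatch D (a :: t) <+: a :: t ∧
    ((longestMatch D (a :: t)).length = 1 ∨ longestMatch D (a :: t) ∈ D) ∧
    ∀ w : List α, w <+: a :: t → (w.length = 1 ∨ w ∈ D) →
      w.length ≤ (longestMatch D (a :: t)).length := by
  have hsort : ∀ l : List α, l.inits.Pairwise (fun u v => u.length ≤ v.length) := by
    intro l
    induction l with
    | nil => simp
    | cons b l ih =>
      rw [List.inits_cons, List.pairwise_cons]
      refine ⟨by simp, ?_⟩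
      rw [List.pairwise_map]
      exact ih.imp (by simp)
  have hmem : [a] ∈ (a :: t).inits.filter (fun w => w.length = 1 ∨ w ∈ D) := by
    simp [List.mem_filter]
  have hne : (a :: t).inits.filter (fun w => w.length = 1 ∨ w ∈ D) ≠ [] :=
    List.ne_nil_of_mem hmem
  have hval : longestMatch D (a :: t) =
      ((a :: t).inits.filter (fun w => w.length = 1 ∨ w ∈ D)).getLast hne := by
    simp only [longestMatch, List.getLast?_eq_getLast_of_ne_nil hne, Option.getD_some]
  have hin := List.getLast_mem hne
  rw [← hval, List.mem_filter, List.mem_inits] at hin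
  refine ⟨hin.1, by simpa using hin.2, ?_⟩
  intro w hw hD
  rw [hval]
  have hp : ((a :: t).inits.filter (fun w => w.length = 1 ∨ w ∈ D)).Pairwise
      (fun u v => u.length ≤ v.length) := (hsort (a :: t)).filter _
  have hwm : w ∈ (a :: t).inits.filter (fun w => w.length = 1 ∨ w ∈ D) := by
    rw [List.mem_filter, List.mem_inits]
    exact ⟨hw, by simpa using hD⟩
  rw [← List.dropLast_append_getLast hne] at hp hwm
  rcases List.mem_append.1 hwm with h | h
  · exact (List.pairwise_append.1 hp).2.2 w h _ (by simp)
  · rw [List.mem_singleton.1 h]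

theorem longestMatch_length_pos {α : Type} [DecidableEq α] (D : List (List α)) (a : α)
    (t : List α) : 0 < (longestMatch D (a :: t)).length :=
  (longestMatch_spec D a t).2.2 [a] ⟨t, rfl⟩ (Or.inl rfl)

/-! ### The LZD parsing and its grammar -/

/-- The LZD parsing of the string in the second argument, where the first argument lists the
phrases that have been produced so far. A phrase `u ++ v` is recorded as the pair `(u, v)`: here `u`
is the longest prefix of the remaining string which is an earlier phrase or a letter, and `v` is the
longest such prefix of what remains after `u` (`v = []` if nothing remains). -/
def lzdFrom {α : Type} [DecidableEq α] (P : List (List α)) : List α → List (List α × List α)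
  | [] => []
  | a :: t =>
    let u := longestMatch P (a :: t)
    let v := longestMatch P ((a :: t).drop u.length)
    (u, v) :: lzdFrom (P ++ [u ++ v]) ((a :: t).drop (u ++ v).length)
  termination_by t => t.length
  decreasing_by
    have := longestMatch_length_pos P a t
    simp only [List.length_drop, List.length_append, List.length_cons]
    omega

/-- The LZD parsing of `s`; each phrase is recorded as the pair of its two parts. -/
def lzdParsing {α : Type} [DecidableEq α] (s : List α) : List (List α × List α) :=
  lzdFrom [] s

/-- How a part `w` of an LZD phrase is written in the grammar: a letter as a terminal, an earlier
phrase as the nonterminal `some j`, where `j` is the index of `w` in the list `P` of all phrases;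
an empty part is left out. -/
def lzdPart {α : Type} [DecidableEq α] (P : List (List α)) : List α → List (Symbol α (Option ℕ))
  | [] => []
  | [a] => [Symbol.terminal a]
  | a :: b :: w => [Symbol.nonterminal (some (P.idxOf (a :: b :: w)))]

/-- The grammar produced by the LZD parsing `p₀ ⋯ p_{z-1}` of `s`: nonterminals `none` (the start
symbol) and `some i` (for the phrase `p_i`), the start rule `none → p₀ ⋯ p_{z-1}`, and for each
phrase the rule that writes it as the concatenation of its two parts. -/
def lzdGrammar {α : Type} [DecidableEq α] (s : List α) : ContextFreeGrammar α where
  NT := Option ℕ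
  initial := none
  rules :=
    let Q := lzdParsing s
    let P := Q.map (fun q => q.1 ++ q.2)
    insert ⟨none, (List.range Q.length).map (fun i => Symbol.nonterminal (some i))⟩
      (Finset.univ.image (fun i : Fin Q.length =>
        ⟨some (i : ℕ), lzdPart P (Q.get i).1 ++ lzdPart P (Q.get i).2⟩))

/-! ### The LZMW parsing and its grammar -/

/-- The concatenations of two adjacent phrases of `P`. -/
def adjacentPairs {α : Type} (P : List (List α)) : List (List α) :=
  List.zipWith (fun u v => u ++ v) P P.tail

/-- The LZMW parsing of the string in the second argument, where the first argument lists the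
phrases that have been produced so far: the next phrase is the longest prefix of the remaining
string which is a letter or a concatenation of two adjacent earlier phrases. -/
def lzmwFrom {α : Type} [DecidableEq α] (P : List (List α)) : List α → List (List α)
  | [] => []
  | a :: t =>
    let u := longestMatch (adjacentPairs P) (a :: t)
    u :: lzmwFrom (P ++ [u]) ((a :: t).drop u.length)
  termination_by t => t.length
  decreasing_by
    have := longestMatch_length_pos (adjacentPairs P) a t
    simp only [List.length_drop, List.length_cons]
    omega

/-- The LZMW parsing of `s`, as the list of its phrases. -/
def lzmwParsing {α : Type} [DecidableEq α] (s : List α) : List (List α) :=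
  lzmwFrom [] s

/-- The right-hand side of the rule of an LZMW phrase `w`: a terminal if `w` is a letter, and
otherwise the pair of nonterminals of the first two adjacent phrases whose concatenation is `w`. -/
def lzmwRhs {α : Type} [DecidableEq α] (P : List (List α)) : List α → List (Symbol α (Option ℕ))
  | [] => []
  | [a] => [Symbol.terminal a]
  | a :: b :: w =>
    let j := (adjacentPairs P).idxOf (a :: b :: w)
    [Symbol.nonterminal (some j), Symbol.nonterminal (some (j + 1))]

/-- The grammar produced by the LZMW parsing `p₀ ⋯ p_{z-1}` of `s`: nonterminals `none` (the start
symbol) and `some i` (for the phrase `p_i`), the start rule `none → p₀ ⋯ p_{z-1}`, and for each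
phrase `p_i` a rule `p_i → p_j p_{j+1}` or `p_i → a`. -/
def lzmwGrammar {α : Type} [DecidableEq α] (s : List α) : ContextFreeGrammar α where
  NT := Option ℕ
  initial := none
  rules :=
    let P := lzmwParsing s
    insert ⟨none, (List.range P.length).map (fun i => Symbol.nonterminal (some i))⟩
      (Finset.univ.image (fun i : Fin P.length => ⟨some (i : ℕ), lzmwRhs P (P.get i)⟩))

/-!
# Strings on which the LZD and LZMW grammars are far from smallest

The hard string is built from the blocks `E j = aʲ m aʲ⁺ᵗ`, where `m` is a marker. In a concatenation
of blocks `E i₁ E i₂ E i₃ ⋯` only the sums `i₁ + i₂`, `i₂ + i₃`, … are visible, as lengths of the runs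
of `a`s between the markers. The indices of the hard string are `i, 3k - i, i, 3k + 1 - i, …, i,
4k - i` for `i = 0, …, k - 1`, in this order. The sums do not depend on `i`, except that each passage
from `i` to `i + 1` adds one `a`; so the string is the `k`-th power of one period
(`hardPeriod`, `exists_blocks`), and it has a grammar of size `O(k)` with nonterminals for the powers
of `a` (`smallestGrammarSize_hardString_le`). On the other hand, all pairs of neighbouring indices
are distinct.

If the dictionary contains all blocks when the parsing reaches this string, then the longest
match is always a single block: a longer match would have to be two blocks that were adjacent
before (`longestMatch_block`). Hence LZMW makes each block a phrase and LZD makes each two blocks a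
phrase, which gives at least `k²` phrases, whereas the length is `O(k³)`.

The blocks are put into the dictionary by preparations of length `O(k²)`. For LZD the marker is `b`,
and `∏ⱼ aʲ⁺¹ b aʲ · aʲ⁺¹ b aʲ⁺¹` is parsed into the displayed factors (`le_length_lzdFrom_prep`). For
LZMW the marker is `d c`, and `∏ᵢ c aⁱ · a · aⁱ d` is parsed into the displayed factors, where
`aⁱ d` and the next `c aⁱ⁺¹` form a block (`le_length_lzmwFrom_prep`). The two constructions use
disjoint alphabets and are concatenated; no LZMW phrase reaches across the border between them
(`le_length_lzmwFrom_append`).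
-/

/-! ### Straight-line grammars -/

/-- The string denoted by a symbol, given the strings denoted by the nonterminals. -/
def symbolValue {α ι : Type} (val : ι → List α) : Symbol α ι → List α
  | .terminal a => [a]
  | .nonterminal i => val i

/-- If every rule preserves the strings denoted by the symbols, then so does every derivation. -/
theorem flatMap_symbolValue_of_derives {α : Type} {g : ContextFreeGrammar α} (val : g.NT → List α)
    (hval : ∀ r ∈ g.rules, r.output.flatMap (symbolValue val) = val r.input)
    {u v : List (Symbol α g.NT)} (h : g.Derives u v) :
    v.flatMap (symbolValue val) = u.flatMap (symbolValue val) := by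
  induction h with
  | refl => rfl
  | tail _ h ih =>
    obtain ⟨r, hr, hrw⟩ := h
    obtain ⟨p, q, rfl, rfl⟩ := hrw.exists_parts
    rw [← ih]
    simp [hval r hr, symbolValue]

theorem derives_flatMap_symbolValue {α : Type} {g : ContextFreeGrammar α} (val : g.NT → List α)
    (u : List (Symbol α g.NT))
    (h : ∀ i, Symbol.nonterminal i ∈ u →
      g.Derives [Symbol.nonterminal i] ((val i).map Symbol.terminal)) :
    g.Derives u ((u.flatMap (symbolValue val)).map Symbol.terminal) := by
  induction u with
  | nil => rfl
  | cons x u ih =>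
    have ih' := (ih fun i hi => h i (List.mem_cons_of_mem _ hi)).append_left
    cases x with
    | terminal a => simpa [symbolValue] using ih' [Symbol.terminal a]
    | nonterminal i =>
      simpa [symbolValue] using
        ((h i (by simp)).append_right u).trans (ih' ((val i).map Symbol.terminal))

/-- An acyclic system of rules in which each nonterminal denotes one string is a grammar of the
string denoted by its start symbol. -/
theorem smallestGrammarSize_le {α ι : Type} (L : List (ContextFreeRule α ι)) (val : ι → List α)
    (rank : ι → ℕ) (hval : ∀ r ∈ L, r.output.flatMap (symbolValue val) = val r.input)
    (hrank : ∀ r ∈ L, ∀ i, Symbol.nonterminal i ∈ r.output →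
      rank i < rank r.input ∧ ∃ r' ∈ L, r'.input = i)
    (start : ι) (hstart : ∃ r ∈ L, r.input = start) :
    smallestGrammarSize (val start) ≤ (L.map fun r => r.output.length).sum := by
  classical
  let g : ContextFreeGrammar α := ⟨ι, start, L.toFinset⟩
  have hgval : ∀ r ∈ g.rules, r.output.flatMap (symbolValue val) = val r.input :=
    fun r hr => hval r (List.mem_toFinset.1 hr)
  have hder : ∀ n, ∀ r ∈ L, rank r.input = n →
      g.Derives [Symbol.nonterminal r.input] ((val r.input).map Symbol.terminal) := by
    intro n
    induction n using Nat.strong_induction_on with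
    | _ n ih =>
      intro r hr hn
      have h1 : g.Produces [Symbol.nonterminal r.input] r.output :=
        ⟨r, List.mem_toFinset.2 hr, ContextFreeRule.Rewrites.input_output⟩
      rw [← hval r hr]
      refine h1.trans_derives (derives_flatMap_symbolValue (g := g) val r.output fun i hi => ?_)
      obtain ⟨hlt, r', hr', rfl⟩ := hrank r hr i hi
      exact ih _ (hn ▸ hlt) r' hr' rfl
  have hlang : g.language = {val start} := by
    ext w
    rw [ContextFreeGrammar.mem_language_iff]
    constructor
    · intro h
      have h2 := flatMap_symbolValue_of_derives (g := g) val hgval h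
      have h3 : (w.map (Symbol.terminal (N := ι))).flatMap (symbolValue val) = w := by
        rw [List.flatMap_map]
        exact List.flatMap_singleton' w
      have h4 : w = val start := by
        rw [← h3]
        simpa [symbolValue] using h2
      exact h4
    · rintro rfl
      obtain ⟨r, hr, rfl⟩ := hstart
      exact hder _ r hr rfl
  refine (Nat.sInf_le ⟨g, hlang, rfl⟩ : smallestGrammarSize (val start) ≤ g.size).trans ?_
  change ∑ r ∈ L.toFinset, r.output.length ≤ _
  clear hval hrank hstart hgval hder hlang
  clear g
  induction L with
  | nil => simp
  | cons r L ih =>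
    rw [List.toFinset_cons, List.map_cons, List.sum_cons]
    by_cases hr : r ∈ L.toFinset
    · rw [Finset.insert_eq_of_mem hr]
      omega
    · rw [Finset.sum_insert hr]
      omega

/-! ### Longest matches and blocks -/

theorem longestMatch_eq {α : Type} [DecidableEq α] {D : List (List α)} {t u : List α}
    (hu : u.length = 1 ∨ u ∈ D) (hpos : u ≠ []) (hut : u <+: t)
    (hmax : ∀ w ∈ D, w <+: t → w.length ≤ u.length) : longestMatch D t = u := by
  cases t with
  | nil => exact absurd (List.prefix_nil.1 hut) hpos
  | cons a t =>
    obtain ⟨h1, h2, h3⟩ := longestMatch_spec D a t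
    have h4 := h3 u hut hu
    have h5 : (longestMatch D (a :: t)).length ≤ u.length := by
      rcases h2 with h2 | h2
      · have := List.length_pos_iff.2 hpos
        omega
      · exact hmax _ h2 h1
    exact (List.prefix_of_prefix_length_le h1 hut h5).eq_of_length (le_antisymm h5 h4)

/-- Two strings starting with a run of `a`s that ends inside both of them agree only if these runs
have the same length. -/
theorem replicate_append_cons_prefix {α : Type} {a x y : α} (hx : x ≠ a) (hy : y ≠ a)
    {i j : ℕ} {X Y : List α}
    (h : List.replicate i a ++ x :: X <+: List.replicate j a ++ y :: Y) :
    i = j ∧ x = y ∧ X <+: Y := by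
  induction i generalizing j with
  | zero =>
    cases j with
    | zero => simpa using h
    | succ j =>
      rw [List.replicate_succ, List.replicate_zero, List.nil_append, List.cons_append,
        List.cons_prefix_cons] at h
      exact absurd h.1 hx
  | succ i ih =>
    cases j with
    | zero =>
      rw [List.replicate_succ, List.replicate_zero, List.nil_append, List.cons_append,
        List.cons_prefix_cons] at h
      exact absurd h.1.symm hy
    | succ j =>
      rw [List.replicate_succ, List.replicate_succ, List.cons_append, List.cons_append,
        List.cons_prefix_cons] at h
      obtain ⟨h0, h⟩ := ih h.2
      exact ⟨by rw [h0], h⟩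

/-- The block `aʲ m aʲ⁺ᵗ`, where the marker `m = c :: m'` is a nonempty word. -/
def block {α : Type} (a c : α) (m' : List α) (t j : ℕ) : List α :=
  List.replicate j a ++ c :: (m' ++ List.replicate (j + t) a)

theorem block_ne_nil {α : Type} {a c : α} {m' : List α} {t j : ℕ} : block a c m' t j ≠ [] := by
  simp [block]

theorem block_append {α : Type} (a c : α) (m' : List α) (t j : ℕ) (R : List α) :
    block a c m' t j ++ R =
      List.replicate j a ++ c :: (m' ++ (List.replicate (j + t) a ++ R)) := by
  simp [block]

/-- Two adjacent blocks determine their indices: the first one is the length of the first run of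
`a`s, and the second one is found from the length of the run between the two markers. -/
theorem block_append_block_prefix {α : Type} {a c : α} {m' : List α} {t : ℕ} (hc : c ≠ a)
    {x y x' y' : ℕ} {R : List α}
    (h : block a c m' t x' ++ block a c m' t y' <+: block a c m' t x ++ block a c m' t y ++ R) :
    x' = x ∧ y' = y := by
  rw [List.append_assoc, block_append, block_append, block_append] at h
  obtain ⟨rfl, -, h⟩ := replicate_append_cons_prefix hc hc h
  rw [List.prefix_append_right_inj, List.prefix_append_right_inj, block] at h
  exact ⟨rfl, (replicate_append_cons_prefix hc hc h).1⟩

/-- Every word of `D` that reaches beyond the marker of the block it starts with is either no longer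
than this block or consists of two adjacent blocks, with indices related by `B`. -/
def DictBound {α : Type} (a c : α) (m' : List α) (t : ℕ) (D : List (List α))
    (B : ℕ → ℕ → Prop) : Prop :=
  ∀ w ∈ D, ∀ j, List.replicate j a ++ c :: m' <+: w → w.length ≤ (block a c m' t j).length ∨
    ∃ x y, B x y ∧ w = block a c m' t x ++ block a c m' t y

theorem DictBound.mono {α : Type} {a c : α} {m' : List α} {t : ℕ} {D : List (List α)}
    {B B' : ℕ → ℕ → Prop} (h : DictBound a c m' t D B) (hB : ∀ x y, B x y → B' x y) :
    DictBound a c m' t D B' := fun w hw j hj =>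
  (h w hw j hj).imp_right fun ⟨x, y, hxy, e⟩ => ⟨x, y, hB x y hxy, e⟩

/-- In front of two blocks that have not been adjacent before, the longest match is the first
of them. -/
theorem longestMatch_block {α : Type} [DecidableEq α] {a c : α} {m' : List α} {t : ℕ} (hc : c ≠ a)
    {D : List (List α)} {B : ℕ → ℕ → Prop} (hD : DictBound a c m' t D B) {x y : ℕ}
    (hx : (block a c m' t x).length = 1 ∨ block a c m' t x ∈ D) (hxy : ¬ B x y) (R : List α) :
    longestMatch D (block a c m' t x ++ (block a c m' t y ++ R)) = block a c m' t x := by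
  refine longestMatch_eq hx block_ne_nil (List.prefix_append _ _) fun w hw hwt => ?_
  by_contra! hlt
  have h1 : List.replicate x a ++ c :: m' <+: w := by
    refine List.prefix_of_prefix_length_le
      (l₃ := block a c m' t x ++ (block a c m' t y ++ R)) ?_ hwt ?_
    · rw [block_append]
      exact ⟨List.replicate (x + t) a ++ (block a c m' t y ++ R), by simp⟩
    · simp [block] at hlt ⊢
      omega
  rcases hD w hw x h1 with h2 | ⟨x', y', hB, rfl⟩
  · omega
  · rw [← List.append_assoc] at hwt
    obtain ⟨rfl, rfl⟩ := block_append_block_prefix hc hwt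
    exact hxy hB

/-- The suffixes of a concatenation of `n` pieces and a remainder. -/
theorem exists_suffixes {α : Type} (f : ℕ → List α) (n : ℕ) (R : List α) :
    ∃ T : ℕ → List α, T 0 = (List.range n).flatMap f ++ R ∧ T n = R ∧
      ∀ j < n, T j = f j ++ T (j + 1) := by
  refine ⟨fun j => (List.range' j (n - j)).flatMap f ++ R, ?_, ?_, fun j hj => ?_⟩
  · simp [List.range_eq_range']
  · simp
  · obtain ⟨d, rfl⟩ := Nat.exists_eq_add_of_lt hj
    have h1 : j + d + 1 - j = d + 1 := by omega
    have h2 : j + d + 1 - (j + 1) = d := by omega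
    simp [h1, h2, List.range'_succ]

/-! ### The LZD parsing of the hard string -/

theorem lzdFrom_append {α : Type} [DecidableEq α] {P : List (List α)} {u v R : List α}
    (hne : u ≠ []) (hu : longestMatch P (u ++ (v ++ R)) = u) (hv : longestMatch P (v ++ R) = v) :
    lzdFrom P (u ++ (v ++ R)) = (u, v) :: lzdFrom (P ++ [u ++ v]) R := by
  obtain ⟨a, u', rfl⟩ := List.exists_cons_of_ne_nil hne
  rw [List.cons_append] at hu ⊢
  rw [lzdFrom]
  simp only [hu]
  rw [← List.cons_append, List.drop_left, hv, ← List.append_assoc, List.drop_left]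

/-- The LZD parsing takes each two blocks `x q`, `y q` as one phrase, provided that no two blocks
are adjacent more than once. -/
theorem le_length_lzdFrom_blocks {α : Type} [DecidableEq α] {a c : α} {m' : List α} {t : ℕ}
    (hc : c ≠ a) {n : ℕ} {x y : ℕ → ℕ} {T : ℕ → List α}
    (hT : ∀ q < n, T q = block a c m' t (x q) ++ (block a c m' t (y q) ++ T (q + 1)))
    (hinj : ∀ p < n, ∀ q < n, x p = x q → y p = y q → p = q)
    (hne : ∀ p < n, ∀ q < n, x p ≠ y q) (d : ℕ) :
    ∀ (q : ℕ) (P : List (List α)), q + d < n →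
      (∀ p < n, ((block a c m' t (x p)).length = 1 ∨ block a c m' t (x p) ∈ P) ∧
        ((block a c m' t (y p)).length = 1 ∨ block a c m' t (y p) ∈ P)) →
      DictBound a c m' t P (fun i j => ∃ p < q, i = x p ∧ j = y p) →
      d ≤ (lzdFrom P (T q)).length := by
  induction d with
  | zero => exact fun _ _ _ _ _ => Nat.zero_le _
  | succ d ih =>
    intro q P hq hP hD
    have hu : longestMatch P (block a c m' t (x q) ++ (block a c m' t (y q) ++ T (q + 1))) =
        block a c m' t (x q) := by
      refine longestMatch_block hc hD (hP q (by omega)).1 ?_ _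
      rintro ⟨p, hp, h1, h2⟩
      exact hp.ne (hinj q (by omega) p (by omega) h1 h2).symm
    have hv : longestMatch P (block a c m' t (y q) ++ T (q + 1)) = block a c m' t (y q) := by
      rw [hT (q + 1) (by omega)]
      refine longestMatch_block hc hD (hP q (by omega)).2 ?_ _
      rintro ⟨p, hp, h1, h2⟩
      exact hne p (by omega) q (by omega) h1.symm
    rw [hT q (by omega), lzdFrom_append block_ne_nil hu hv, List.length_cons]
    refine Nat.succ_le_succ (ih (q + 1) _ (by omega) (fun p hp => ?_) fun w hw j hj => ?_)
    · exact ⟨(hP p hp).1.imp_right (List.mem_append_left _),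
        (hP p hp).2.imp_right (List.mem_append_left _)⟩
    · rcases List.mem_append.1 hw with hw | hw
      · exact hD.mono (fun _ _ ⟨p, hp, h⟩ => ⟨p, by omega, h⟩) w hw j hj
      · exact Or.inr ⟨x q, y q, ⟨q, by omega, rfl, rfl⟩, List.mem_singleton.1 hw⟩

/-- The piece `aʲ⁺¹ b a²ʲ⁺¹ b aʲ⁺¹` of the LZD preparation, which is parsed into the phrases
`aʲ⁺¹ b aʲ` and `aʲ⁺¹ b aʲ⁺¹`. -/
def lzdPiece {α : Type} (a b : α) (j : ℕ) : List α :=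
  List.replicate (j + 1) a ++ b :: (List.replicate (2 * j + 1) a ++ b :: List.replicate (j + 1) a)

/-- The LZD preparation: after it, the blocks `aʲ b aʲ` with `1 ≤ j ≤ K` are phrases. It ends with
the first half of another piece, so that the phrase that completes the block of index `K` is followed
by `a`s and does not run into the hard part. -/
def lzdPrep {α : Type} (a b : α) (K : ℕ) : List α :=
  (List.range K).flatMap (lzdPiece a b) ++
    (List.replicate (K + 1) a ++ b :: List.replicate K a)

/-- A word `aʲ b aʲ⁻¹` or `aʲ b aʲ` with `j ≥ 1`, where `j = i + 1`. -/
def IsLzdWord {α : Type} (a b : α) (i : ℕ) (w : List α) : Prop :=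
  w = List.replicate (i + 1) a ++ b :: List.replicate i a ∨ w = block a b [] 0 (i + 1)

theorem IsLzdWord.exists_eq {α : Type} {a b : α} {i : ℕ} {w : List α} (h : IsLzdWord a b i w) :
    ∃ e ≤ i + 1, w = List.replicate (i + 1) a ++ b :: List.replicate e a := by
  rcases h with rfl | rfl
  · exact ⟨i, by omega, rfl⟩
  · exact ⟨i + 1, le_rfl, by simp [block]⟩

/-- A text starting with `aʲ b` is matched by the words with `j` leading `a`s only. -/
theorem IsLzdWord.prefix {α : Type} {a b : α} (hb : b ≠ a) {i j : ℕ} {w R : List α}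
    (h : IsLzdWord a b i w) (hw : w <+: List.replicate j a ++ b :: R) :
    i + 1 = j ∧ w.length ≤ j + 1 + j := by
  obtain ⟨e, he, rfl⟩ := h.exists_eq
  obtain ⟨rfl, -⟩ := replicate_append_cons_prefix hb hb hw
  simp
  omega

theorem longestMatch_letter_of_lzdWords {α : Type} [DecidableEq α] {a b : α} (hb : b ≠ a)
    {j n : ℕ} {P : List (List α)} {R : List α} (hP : ∀ w ∈ P, ∃ i < n, IsLzdWord a b i w)
    (hj : n ≤ j) : longestMatch P ([a] ++ (List.replicate j a ++ b :: R)) = [a] := by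
  refine longestMatch_eq (Or.inl rfl) (by simp) (List.prefix_append _ _) fun w hw hwt => ?_
  obtain ⟨i, hi, h⟩ := hP w hw
  rw [← List.append_assoc, ← List.replicate_one, List.replicate_append_replicate] at hwt
  have := (h.prefix hb hwt).1
  omega

theorem longestMatch_block_of_lzdWords {α : Type} [DecidableEq α] {a b : α} (hb : b ≠ a)
    {j : ℕ} {P : List (List α)} {R : List α} (hP : ∀ w ∈ P, ∃ i, IsLzdWord a b i w)
    (hj : 0 < j → block a b [] 0 j ∈ P) :
    longestMatch P (block a b [] 0 j ++ R) = block a b [] 0 j := by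
  refine longestMatch_eq ?_ block_ne_nil (List.prefix_append _ _) fun w hw hwt => ?_
  · rcases Nat.eq_zero_or_pos j with rfl | h
    · exact Or.inl rfl
    · exact Or.inr (hj h)
  · obtain ⟨i, h⟩ := hP w hw
    rw [block_append] at hwt
    have := (h.prefix hb hwt).2
    simp [block]
    omega

/-- A lower bound for the parsing of `X` that holds for all dictionaries as left by the LZD preparation
holds for the parsing of the preparation followed by `X`. -/
theorem le_length_lzdFrom_prep {α : Type} [DecidableEq α] {a b : α} (hb : b ≠ a) {K C : ℕ}
    {X : List α}
    (hX : ∀ P : List (List α), (∀ w ∈ P, ∃ i, IsLzdWord a b i w) →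
      (∀ j, 0 < j → j ≤ K → block a b [] 0 j ∈ P) → C ≤ (lzdFrom P X).length) :
    C ≤ (lzdParsing (lzdPrep a b K ++ X)).length := by
  obtain ⟨T, h0, hK, hT⟩ := exists_suffixes (lzdPiece a b) K
    ((List.replicate (K + 1) a ++ b :: List.replicate K a) ++ X)
  have hhead : ∀ j ≤ K, ∃ R, T j = List.replicate (j + 1) a ++ b :: R := by
    intro j hj
    rcases hj.lt_or_eq with hj | rfl
    · exact ⟨_, by rw [hT j hj, lzdPiece, List.append_assoc, List.cons_append]⟩
    · exact ⟨_, by rw [hK, List.append_assoc, List.cons_append]⟩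
  -- The first phrase of each piece: `a` followed by the block of index `j`.
  have hfirst : ∀ (j : ℕ) (P : List (List α)) (R : List α),
      (∀ w ∈ P, ∃ i < j, IsLzdWord a b i w) → (∀ i, 0 < i → i ≤ j → block a b [] 0 i ∈ P) →
      lzdFrom P ([a] ++ (block a b [] 0 j ++ R)) =
        ([a], block a b [] 0 j) :: lzdFrom (P ++ [[a] ++ block a b [] 0 j]) R := by
    intro j P R h1 h2
    refine lzdFrom_append (by simp) ?_ ?_
    · rw [block_append]
      exact longestMatch_letter_of_lzdWords hb h1 le_rfl
    · exact longestMatch_block_of_lzdWords hb (fun w hw => (h1 w hw).imp fun _ h => h.2)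
        fun hj => h2 j hj le_rfl
  have hword : ∀ j, [a] ++ block a b [] 0 j =
      List.replicate (j + 1) a ++ b :: List.replicate j a := by
    intro j
    simp [block, List.replicate_succ]
  have main : ∀ d j : ℕ, j + d = K → ∀ P : List (List α),
      (∀ w ∈ P, ∃ i < j, IsLzdWord a b i w) → (∀ i, 0 < i → i ≤ j → block a b [] 0 i ∈ P) →
      C ≤ (lzdFrom P (T j)).length := by
    intro d
    induction d with
    | zero =>
      rintro j rfl P h1 h2
      rw [Nat.add_zero] at *
      rw [hK, ← hword, List.append_assoc, hfirst j P X h1 h2, List.length_cons]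
      refine (hX _ (fun w hw => ?_) fun i hi hij => List.mem_append_left _ (h2 i hi hij)).trans
        (Nat.le_succ _)
      rcases List.mem_append.1 hw with hw | hw
      · exact (h1 w hw).imp fun _ h => h.2
      · exact ⟨j, Or.inl (by rw [List.mem_singleton.1 hw, hword])⟩
    | succ d ih =>
      intro j hj P h1 h2
      have e : T j = [a] ++ (block a b [] 0 j ++
          ((List.replicate (j + 1) a ++ b :: List.replicate j a) ++ ([a] ++ T (j + 1)))) := by
        have e1 : List.replicate (2 * j + 1) a =
            List.replicate j a ++ List.replicate (j + 1) a := by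
          rw [List.replicate_append_replicate]
          congr 1
          omega
        have e2 : lzdPiece a b j = (List.replicate (j + 1) a ++ b :: List.replicate j a) ++
            ((List.replicate (j + 1) a ++ b :: List.replicate j a) ++ [a]) := by
          rw [lzdPiece, e1]
          simp only [List.append_assoc, List.cons_append, ← List.replicate_succ']
        rw [hT j (by omega), e2, ← List.append_assoc [a], hword]
        simp only [List.append_assoc]
      obtain ⟨R, hR⟩ := hhead (j + 1) (by omega)
      have h1' : ∀ w ∈ P ++ [[a] ++ block a b [] 0 j], ∃ i < j + 1, IsLzdWord a b i w := by
        intro w hw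
        rcases List.mem_append.1 hw with hw | hw
        · obtain ⟨i, hi, h⟩ := h1 w hw
          exact ⟨i, by omega, h⟩
        · exact ⟨j, by omega, Or.inl (by rw [List.mem_singleton.1 hw, hword])⟩
      have hu : longestMatch (P ++ [[a] ++ block a b [] 0 j])
          ((List.replicate (j + 1) a ++ b :: List.replicate j a) ++ ([a] ++ T (j + 1))) =
          List.replicate (j + 1) a ++ b :: List.replicate j a := by
        refine longestMatch_eq (Or.inr (by simp [hword])) (by simp) (List.prefix_append _ _)
          fun w hw hwt => ?_
        rcases List.mem_append.1 hw with hw | hw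
        · obtain ⟨i, hi, h⟩ := h1 w hw
          rw [List.append_assoc, List.cons_append] at hwt
          have := (h.prefix hb hwt).1
          omega
        · rw [List.mem_singleton.1 hw, hword]
      have hv : longestMatch (P ++ [[a] ++ block a b [] 0 j]) ([a] ++ T (j + 1)) = [a] := by
        rw [hR]
        exact longestMatch_letter_of_lzdWords hb h1' (by omega)
      have hblock : (List.replicate (j + 1) a ++ b :: List.replicate j a) ++ [a] =
          block a b [] 0 (j + 1) := by
        simp [block, ← List.replicate_succ']
      rw [e, hfirst j P _ h1 h2, lzdFrom_append (by simp) hu hv, hblock, List.length_cons,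
        List.length_cons]
      refine le_trans (ih (j + 1) (by omega) _ (fun w hw => ?_) fun i hi hij => ?_)
        ((Nat.le_succ _).trans (Nat.le_succ _))
      · rcases List.mem_append.1 hw with hw | hw
        · exact h1' w hw
        · exact ⟨j, by omega, Or.inr (List.mem_singleton.1 hw)⟩
      · rcases hij.lt_or_eq with hij | rfl
        · exact List.mem_append_left _ (List.mem_append_left _ (h2 i hi (by omega)))
        · exact List.mem_append_right _ (List.mem_singleton_self _)
  rw [lzdParsing, lzdPrep, List.append_assoc, ← h0]
  exact main K 0 (by omega) [] (by simp) fun i hi hi' => by omega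

/-! ### The LZMW parsing of the hard string -/

theorem lzmwFrom_append {α : Type} [DecidableEq α] {P : List (List α)} {u R : List α}
    (hne : u ≠ []) (hu : longestMatch (adjacentPairs P) (u ++ R) = u) :
    lzmwFrom P (u ++ R) = u :: lzmwFrom (P ++ [u]) R := by
  obtain ⟨a, u', rfl⟩ := List.exists_cons_of_ne_nil hne
  rw [List.cons_append] at hu ⊢
  rw [lzmwFrom]
  simp only [hu]
  rw [← List.cons_append, List.drop_left]

theorem mem_adjacentPairs_concat {α : Type} {P : List (List α)} {u w : List α} :
    w ∈ adjacentPairs (P ++ [u]) ↔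
      w ∈ adjacentPairs P ∨ ∃ p, P.getLast? = some p ∧ w = p ++ u := by
  induction P with
  | nil => simp [adjacentPairs]
  | cons p P ih =>
    cases P with
    | nil => simp [adjacentPairs]
    | cons p' P =>
      have h : ∀ Q : List (List α), adjacentPairs (p :: p' :: Q) =
          (p ++ p') :: adjacentPairs (p' :: Q) := fun Q => rfl
      rw [List.cons_append, List.cons_append, h, h, List.mem_cons, List.mem_cons,
        ← List.cons_append, ih, List.getLast?_cons_cons, or_assoc]

theorem exists_of_mem_adjacentPairs {α : Type} {P : List (List α)} {w : List α}
    (h : w ∈ adjacentPairs P) : ∃ p ∈ P, ∃ q ∈ P, w = p ++ q := by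
  induction P using List.reverseRecOn with
  | nil => simp [adjacentPairs] at h
  | append_singleton P u ih =>
    rcases mem_adjacentPairs_concat.1 h with h | ⟨p, hp, rfl⟩
    · obtain ⟨p, hp, q, hq, rfl⟩ := ih h
      exact ⟨p, List.mem_append_left _ hp, q, List.mem_append_left _ hq, rfl⟩
    · exact ⟨p, List.mem_append_left _ (List.mem_of_getLast? hp), u, by simp, rfl⟩

/-- If `L` holds for the letters of `X` and for no letter of `Y`, then no phrase of the LZMW parsing
of `X ++ Y` reaches across the border: a word of the dictionary has occurred in `X` before. -/
theorem le_length_lzmwFrom_append {α : Type} [DecidableEq α] {L : α → Prop} {Y : List α} {C : ℕ}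
    (hY : ∀ y ∈ Y, ¬ L y)
    (hC : ∀ P : List (List α), (∀ p ∈ P, p ≠ [] ∧ ∀ x ∈ p, L x) → C ≤ (lzmwFrom P Y).length) :
    ∀ (n : ℕ) (X : List α), X.length = n → (∀ x ∈ X, L x) →
      ∀ P : List (List α), (∀ p ∈ P, p ≠ [] ∧ ∀ x ∈ p, L x) →
        C ≤ (lzmwFrom P (X ++ Y)).length := by
  intro n
  induction n using Nat.strong_induction_on with
  | _ n ih =>
    intro X hn hX P hP
    cases X with
    | nil => exact hC P hP
    | cons a X =>
      obtain ⟨h1, h2, -⟩ := longestMatch_spec (adjacentPairs P) a (X ++ Y)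
      have hpos := longestMatch_length_pos (adjacentPairs P) a (X ++ Y)
      obtain ⟨u, hu⟩ : ∃ u, longestMatch (adjacentPairs P) (a :: (X ++ Y)) = u := ⟨_, rfl⟩
      rw [hu] at h1 h2 hpos
      have hL : ∀ x ∈ u, L x := by
        rcases h2 with h2 | h2
        · obtain ⟨b, rfl⟩ := List.length_eq_one_iff.1 h2
          rw [List.cons_prefix_cons] at h1
          rw [h1.1]
          simpa using hX a (by simp)
        · obtain ⟨p, hp, q, hq, rfl⟩ := exists_of_mem_adjacentPairs h2
          intro x hx
          exact (List.mem_append.1 hx).elim ((hP p hp).2 x) ((hP q hq).2 x)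
      have hlen : u.length ≤ (a :: X).length := by
        by_contra! hlt
        obtain ⟨V, rfl⟩ : (a :: X) <+: u :=
          List.prefix_of_prefix_length_le (l₃ := a :: (X ++ Y)) ⟨Y, by simp⟩ h1 hlt.le
        rw [← List.cons_append, List.prefix_append_right_inj] at h1
        rw [List.length_append] at hlt
        obtain ⟨y, hy⟩ := List.exists_mem_of_length_pos (l := V) (by omega)
        exact hY y (h1.subset hy) (hL y (List.mem_append_right _ hy))
      obtain ⟨X', hX'⟩ : u <+: (a :: X) :=
        List.prefix_of_prefix_length_le (l₃ := a :: (X ++ Y)) h1 ⟨Y, by simp⟩ hlen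
      have hne : u ≠ [] := List.length_pos_iff.1 hpos
      rw [← List.cons_append, ← hX', List.append_assoc] at hu
      rw [← hX', List.append_assoc, lzmwFrom_append hne hu, List.length_cons]
      refine (ih X'.length ?_ X' rfl (fun x hx => hX x ?_) _ fun p hp => ?_).trans (Nat.le_succ _)
      · rw [← hn, ← hX', List.length_append]
        omega
      · rw [← hX']
        exact List.mem_append_right _ hx
      · rcases List.mem_append.1 hp with hp | hp
        · exact hP p hp
        · rw [List.mem_singleton.1 hp]
          exact ⟨hne, hL⟩

/-- The LZMW parsing takes each block `x q` or `y q` as one phrase, provided that no two blocks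
are adjacent more than once. Here the block `x q` has just been parsed. -/
theorem le_length_lzmwFrom_blocks {α : Type} [DecidableEq α] {a c : α} {m' : List α} {t : ℕ}
    (hc : c ≠ a) {n : ℕ} {x y : ℕ → ℕ} {T : ℕ → List α}
    (hT : ∀ q < n, T q = block a c m' t (x q) ++ (block a c m' t (y q) ++ T (q + 1)))
    (hinj : ∀ p < n, ∀ q < n, x p = x q → y p = y q → p = q)
    (hinj' : ∀ p < n, ∀ q < n, y p = y q → x (p + 1) = x (q + 1) → p = q)
    (hne : ∀ p < n, ∀ q < n, x p ≠ y q) (d : ℕ) :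
    ∀ (q : ℕ) (P : List (List α)), q + d < n →
      P.getLast? = some (block a c m' t (x q)) →
      (∀ p < n, block a c m' t (x p) ∈ adjacentPairs P ∧ block a c m' t (y p) ∈ adjacentPairs P) →
      DictBound a c m' t (adjacentPairs P)
        (fun i j => ∃ p < q, i = x p ∧ j = y p ∨ i = y p ∧ j = x (p + 1)) →
      d ≤ (lzmwFrom P (block a c m' t (y q) ++ T (q + 1))).length := by
  induction d with
  | zero => exact fun _ _ _ _ _ _ => Nat.zero_le _
  | succ d ih =>
    intro q P hq hlast hP hD
    have hu : longestMatch (adjacentPairs P) (block a c m' t (y q) ++ T (q + 1)) =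
        block a c m' t (y q) := by
      rw [hT (q + 1) (by omega)]
      refine longestMatch_block hc hD (Or.inr (hP q (by omega)).2) ?_ _
      rintro ⟨p, hp, ⟨h1, h2⟩ | ⟨h1, h2⟩⟩
      · exact hne p (by omega) q (by omega) h1.symm
      · exact hp.ne (hinj' q (by omega) p (by omega) h1 h2).symm
    have hP1 : ∀ p < n, block a c m' t (x p) ∈ adjacentPairs (P ++ [block a c m' t (y q)]) ∧
        block a c m' t (y p) ∈ adjacentPairs (P ++ [block a c m' t (y q)]) := fun p hp =>
      ⟨mem_adjacentPairs_concat.2 (Or.inl (hP p hp).1),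
        mem_adjacentPairs_concat.2 (Or.inl (hP p hp).2)⟩
    have hD1 : DictBound a c m' t (adjacentPairs (P ++ [block a c m' t (y q)]))
        (fun i j => (∃ p < q, i = x p ∧ j = y p ∨ i = y p ∧ j = x (p + 1)) ∨
          i = x q ∧ j = y q) := by
      intro w hw j hj
      rcases mem_adjacentPairs_concat.1 hw with hw | ⟨p, hp, rfl⟩
      · exact hD.mono (fun _ _ h => Or.inl h) w hw j hj
      · rw [hlast, Option.some_inj] at hp
        exact Or.inr ⟨x q, y q, Or.inr ⟨rfl, rfl⟩, by rw [hp]⟩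
    have hv : longestMatch (adjacentPairs (P ++ [block a c m' t (y q)]))
        (block a c m' t (x (q + 1)) ++ (block a c m' t (y (q + 1)) ++ T (q + 1 + 1))) =
        block a c m' t (x (q + 1)) := by
      refine longestMatch_block hc hD1 (Or.inr (hP1 (q + 1) (by omega)).1) ?_ _
      rintro (⟨p, hp, ⟨h1, h2⟩ | ⟨h1, h2⟩⟩ | ⟨h1, h2⟩)
      · have := hinj (q + 1) (by omega) p (by omega) h1 h2
        omega
      · exact hne (q + 1) (by omega) p (by omega) h1
      · have := hinj (q + 1) (by omega) q (by omega) h1 h2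
        omega
    rw [lzmwFrom_append block_ne_nil hu, hT (q + 1) (by omega), lzmwFrom_append block_ne_nil hv,
      List.length_cons, List.length_cons]
    refine Nat.succ_le_succ ((ih (q + 1) _ (by omega) (by simp) (fun p hp => ?_)
      fun w hw j hj => ?_).trans (Nat.le_succ _))
    · exact ⟨mem_adjacentPairs_concat.2 (Or.inl (hP1 p hp).1),
        mem_adjacentPairs_concat.2 (Or.inl (hP1 p hp).2)⟩
    · rcases mem_adjacentPairs_concat.1 hw with hw | ⟨p, hp, rfl⟩
      · refine hD1.mono ?_ w hw j hj
        rintro i j (⟨p, hp, h⟩ | h)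
        · exact ⟨p, by omega, h⟩
        · exact ⟨q, by omega, Or.inl h⟩
      · rw [List.getLast?_concat, Option.some_inj] at hp
        exact Or.inr ⟨y q, x (q + 1), ⟨q, by omega, Or.inr ⟨rfl, rfl⟩⟩, by rw [hp]⟩

/-- The LZMW preparation. Its piece `c a²ⁱ⁺¹ d` is parsed into `c aⁱ`, `a`, `aⁱ d`, which puts
`c aⁱ⁺¹` and `aⁱ⁺¹ d` into the dictionary; with the next phrase `c aⁱ⁺¹`, so is the block
`aⁱ d c aⁱ⁺¹`. -/
def lzmwPrep {α : Type} (a c d : α) (K : ℕ) : List α :=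
  (List.range (K + 1)).flatMap fun i => c :: (List.replicate (2 * i + 1) a ++ [d])

/-- The words of the LZMW dictionary during the preparation: `c aʲ` with `j ≤ n₁`, `aʲ d` with
`j ≤ n₂`, blocks of index `j < n₃`, and words starting with a letter other than `a`, `c`, `d`. -/
def IsLzmwWord {α : Type} (a c d : α) (n₁ n₂ n₃ : ℕ) (w : List α) : Prop :=
  (∃ j ≤ n₁, w = c :: List.replicate j a) ∨ (∃ j ≤ n₂, w = List.replicate j a ++ [d]) ∨
    (∃ j < n₃, w = block a d [c] 1 j) ∨ ∃ x X, x ≠ a ∧ x ≠ c ∧ x ≠ d ∧ w = x :: X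

/-- How a dictionary word can match a text that starts with a run of `a`s ended by `z`. -/
theorem IsLzmwWord.prefix {α : Type} {a c d : α} (hca : c ≠ a) (hda : d ≠ a)
    {n₁ n₂ n₃ : ℕ} {w : List α} (h : IsLzmwWord a c d n₁ n₂ n₃ w) {i : ℕ} {z : α} {R : List α}
    (hz : z = c ∨ z = d) (hw : w <+: List.replicate i a ++ z :: R) :
    (z = c ∧ w.length ≤ n₁ + 1) ∨
      (z = d ∧ (i ≤ n₂ ∧ w.length = i + 1 ∨ i < n₃ ∧ w.length = 2 * i + 3)) := by
  have hza : z ≠ a := by rcases hz with rfl | rfl <;> assumption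
  rcases h with ⟨j, hj, rfl⟩ | ⟨j, hj, rfl⟩ | ⟨j, hj, rfl⟩ | ⟨x, X, h1, h2, h3, rfl⟩
  · obtain ⟨-, rfl, -⟩ := replicate_append_cons_prefix (i := 0) hca hza hw
    exact Or.inl ⟨rfl, by simp; omega⟩
  · obtain ⟨rfl, rfl, -⟩ := replicate_append_cons_prefix hda hza hw
    exact Or.inr ⟨rfl, Or.inl ⟨hj, by simp⟩⟩
  · obtain ⟨rfl, rfl, -⟩ := replicate_append_cons_prefix hda hza hw
    exact Or.inr ⟨rfl, Or.inr ⟨hj, by simp [block]; omega⟩⟩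
  · obtain ⟨-, rfl, -⟩ := replicate_append_cons_prefix (i := 0) h1 hza hw
    rcases hz with h | h
    · exact absurd h h2
    · exact absurd h h3

theorem IsLzmwWord.mono {α : Type} {a c d : α} {n₁ n₂ n₃ n₁' n₂' n₃' : ℕ} {w : List α}
    (h : IsLzmwWord a c d n₁ n₂ n₃ w) (h1 : n₁ ≤ n₁') (h2 : n₂ ≤ n₂') (h3 : n₃ ≤ n₃') :
    IsLzmwWord a c d n₁' n₂' n₃' w := by
  rcases h with ⟨j, hj, rfl⟩ | ⟨j, hj, rfl⟩ | ⟨j, hj, rfl⟩ | h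
  · exact Or.inl ⟨j, hj.trans h1, rfl⟩
  · exact Or.inr (Or.inl ⟨j, hj.trans h2, rfl⟩)
  · exact Or.inr (Or.inr (Or.inl ⟨j, hj.trans_le h3, rfl⟩))
  · exact Or.inr (Or.inr (Or.inr h))

/-- The words of the preparation that reach beyond the marker of a block are blocks. -/
theorem IsLzmwWord.length_le {α : Type} {a c d : α} (hca : c ≠ a) (hda : d ≠ a) (hcd : c ≠ d)
    {n₁ n₂ n₃ : ℕ} {w : List α} (h : IsLzmwWord a c d n₁ n₂ n₃ w) {j : ℕ}
    (hj : List.replicate j a ++ [d, c] <+: w) : w.length ≤ (block a d [c] 1 j).length := by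
  rcases h with ⟨i, hi, rfl⟩ | ⟨i, hi, rfl⟩ | ⟨i, hi, rfl⟩ | ⟨x, X, h1, h2, h3, rfl⟩
  · exact absurd (replicate_append_cons_prefix (j := 0) hda hca hj).2.1.symm hcd
  · have := (replicate_append_cons_prefix hda hda hj).2.2
    simp at this
  · rw [(replicate_append_cons_prefix hda hda hj).1]
  · exact absurd (replicate_append_cons_prefix (j := 0) hda h1 hj).2.1.symm h3

/-- The LZMW parsing of the preparation, seen from the point where `c aⁱ` has just been parsed. -/
theorem le_length_lzmwFrom_prep_aux {α : Type} [DecidableEq α] {a c d : α} (hca : c ≠ a)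
    (hda : d ≠ a) (hcd : c ≠ d) {K C : ℕ} {X : List α} {T : ℕ → List α}
    (hTK : T K = List.replicate (K + 1) a ++ d :: d :: X)
    (hT : ∀ i < K, T i =
      List.replicate (i + 1) a ++ d :: (c :: (List.replicate (i + 1) a ++ T (i + 1))))
    (hX : ∀ P : List (List α), P.getLast? = some (List.replicate K a ++ [d]) →
      (∀ w ∈ adjacentPairs P, IsLzmwWord a c d (K + 1) (K + 1) K w) →
      (∀ j < K, block a d [c] 1 j ∈ adjacentPairs P) → C ≤ (lzmwFrom P (d :: X)).length)
    (e : ℕ) :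
    ∀ (i : ℕ) (P : List (List α)), i + e = K → P.getLast? = some (c :: List.replicate i a) →
      (∀ w ∈ adjacentPairs P, IsLzmwWord a c d i i i w) →
      (∀ j, 0 < j → j ≤ i → c :: List.replicate j a ∈ adjacentPairs P ∧
        List.replicate j a ++ [d] ∈ adjacentPairs P) →
      (∀ j < i, block a d [c] 1 j ∈ adjacentPairs P) → C ≤ (lzmwFrom P (T i)).length := by
  -- The two phrases `a` and `aⁱ d`, followed by a letter other than `a`.
  have hstep : ∀ (i : ℕ) (P : List (List α)) (R : List α),
      P.getLast? = some (c :: List.replicate i a) →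
      (∀ w ∈ adjacentPairs P, IsLzmwWord a c d i i i w) →
      (∀ j, 0 < j → j ≤ i → c :: List.replicate j a ∈ adjacentPairs P ∧
        List.replicate j a ++ [d] ∈ adjacentPairs P) →
      lzmwFrom P (List.replicate (i + 1) a ++ d :: R) = [a] :: (List.replicate i a ++ [d]) ::
        lzmwFrom (P ++ [[a]] ++ [List.replicate i a ++ [d]]) R ∧
      (∀ w ∈ adjacentPairs (P ++ [[a]] ++ [List.replicate i a ++ [d]]),
        IsLzmwWord a c d (i + 1) (i + 1) i w) ∧
      ∀ j, 0 < j → j ≤ i + 1 →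
        c :: List.replicate j a ∈ adjacentPairs (P ++ [[a]] ++ [List.replicate i a ++ [d]]) ∧
        List.replicate j a ++ [d] ∈ adjacentPairs (P ++ [[a]] ++ [List.replicate i a ++ [d]]) := by
    intro i P R hlast hword hmem
    have hu : longestMatch (adjacentPairs P) ([a] ++ (List.replicate i a ++ d :: R)) = [a] := by
      refine longestMatch_eq (Or.inl rfl) (by simp) (List.prefix_append _ _) fun w hw hwt => ?_
      rw [← List.append_assoc, ← List.replicate_one, List.replicate_append_replicate] at hwt
      rcases (hword w hw).prefix hca hda (Or.inr rfl) hwt with h | h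
      · exact absurd h.1.symm hcd
      · omega
    have hword1 : ∀ w ∈ adjacentPairs (P ++ [[a]]), IsLzmwWord a c d (i + 1) i i w := by
      intro w hw
      rcases mem_adjacentPairs_concat.1 hw with hw | ⟨p, hp, rfl⟩
      · exact (hword w hw).mono (by omega) le_rfl le_rfl
      · rw [hlast, Option.some_inj] at hp
        exact Or.inl ⟨i + 1, le_rfl, by rw [← hp, List.replicate_succ', List.cons_append]⟩
    have hv : longestMatch (adjacentPairs (P ++ [[a]])) ((List.replicate i a ++ [d]) ++ R) =
        List.replicate i a ++ [d] := by
      refine longestMatch_eq ?_ (by simp) (List.prefix_append _ _) fun w hw hwt => ?_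
      · rcases Nat.eq_zero_or_pos i with rfl | h
        · exact Or.inl rfl
        · exact Or.inr (mem_adjacentPairs_concat.2 (Or.inl (hmem i h le_rfl).2))
      · rw [List.append_assoc, List.cons_append] at hwt
        rcases (hword1 w hw).prefix hca hda (Or.inr rfl) hwt with h | h
        · exact absurd h.1.symm hcd
        · simp
          omega
    refine ⟨?_, fun w hw => ?_, fun j h0 hj => ?_⟩
    · have e1 : List.replicate (i + 1) a ++ d :: R = [a] ++ ((List.replicate i a ++ [d]) ++ R) := by
        simp [List.replicate_succ]
      rw [e1, lzmwFrom_append (by simp) (by simpa using hu), lzmwFrom_append (by simp) hv]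
    · rcases mem_adjacentPairs_concat.1 hw with hw | ⟨p, hp, rfl⟩
      · exact (hword1 w hw).mono le_rfl (by omega) le_rfl
      · rw [List.getLast?_concat, Option.some_inj] at hp
        exact Or.inr (Or.inl ⟨i + 1, le_rfl, by rw [← hp]; simp [List.replicate_succ]⟩)
    · rcases hj.lt_or_eq with hj | rfl
      · have := hmem j h0 (by omega)
        exact ⟨mem_adjacentPairs_concat.2 (Or.inl (mem_adjacentPairs_concat.2 (Or.inl this.1))),
          mem_adjacentPairs_concat.2 (Or.inl (mem_adjacentPairs_concat.2 (Or.inl this.2)))⟩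
      · refine ⟨mem_adjacentPairs_concat.2 (Or.inl (mem_adjacentPairs_concat.2 (Or.inr
          ⟨_, hlast, ?_⟩))), mem_adjacentPairs_concat.2 (Or.inr ⟨[a], by simp, ?_⟩)⟩
        · rw [List.replicate_succ', List.cons_append]
        · simp [List.replicate_succ]
  induction e with
  | zero =>
    rintro i P rfl hlast hword hmem hblock
    rw [Nat.add_zero] at *
    obtain ⟨h1, h2, h3⟩ := hstep i P (d :: X) hlast hword hmem
    rw [hTK, h1, List.length_cons, List.length_cons]
    refine le_trans (hX _ (by simp) h2 fun j hj => ?_) ((Nat.le_succ _).trans (Nat.le_succ _))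
    exact mem_adjacentPairs_concat.2 (Or.inl (mem_adjacentPairs_concat.2 (Or.inl (hblock j hj))))
  | succ e ih =>
    intro i P hi hlast hword hmem hblock
    obtain ⟨h1, h2, h3⟩ := hstep i P (c :: (List.replicate (i + 1) a ++ T (i + 1))) hlast hword hmem
    rw [hT i (by omega), h1]
    generalize hQ : P ++ [[a]] ++ [List.replicate i a ++ [d]] = Q at *
    have hQlast : Q.getLast? = some (List.replicate i a ++ [d]) := by rw [← hQ]; simp
    have hQblock : ∀ j < i, block a d [c] 1 j ∈ adjacentPairs Q := by
      rw [← hQ]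
      exact fun j hj => mem_adjacentPairs_concat.2
        (Or.inl (mem_adjacentPairs_concat.2 (Or.inl (hblock j hj))))
    have hu : longestMatch (adjacentPairs Q) ((c :: List.replicate (i + 1) a) ++ T (i + 1)) =
        c :: List.replicate (i + 1) a := by
      refine longestMatch_eq (Or.inr (h3 (i + 1) (by omega) le_rfl).1) (by simp)
        (List.prefix_append _ _) fun w hw hwt => ?_
      rcases (h2 w hw).prefix (i := 0) hca hda (Or.inl rfl) hwt with h | h
      · simpa using h.2
      · exact absurd h.1 hcd
    have hpair : (List.replicate i a ++ [d]) ++ c :: List.replicate (i + 1) a =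
        block a d [c] 1 i := by
      simp [block]
    rw [← List.cons_append, lzmwFrom_append (by simp) hu]
    refine le_trans (ih (i + 1) (Q ++ [c :: List.replicate (i + 1) a]) (by omega) (by simp)
      (fun w hw => ?_) (fun j h0 hj => ?_) fun j hj => ?_) (Nat.le_add_right _ 3)
    · rcases mem_adjacentPairs_concat.1 hw with hw | ⟨p, hp, rfl⟩
      · exact (h2 w hw).mono le_rfl le_rfl (by omega)
      · rw [hQlast, Option.some_inj] at hp
        exact Or.inr (Or.inr (Or.inl ⟨i, by omega, by rw [← hp, hpair]⟩))
    · have := h3 j h0 hj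
      exact ⟨mem_adjacentPairs_concat.2 (Or.inl this.1), mem_adjacentPairs_concat.2 (Or.inl this.2)⟩
    · rcases Nat.lt_succ_iff_lt_or_eq.1 hj with hj | rfl
      · exact mem_adjacentPairs_concat.2 (Or.inl (hQblock j hj))
      · exact mem_adjacentPairs_concat.2 (Or.inr ⟨_, hQlast, hpair.symm⟩)

/-- A lower bound for the parsing of `d :: X` that holds for all dictionaries as left by the LZMW
preparation holds for the parsing of the preparation followed by `d :: X`, also after a text over
other letters. -/
theorem le_length_lzmwFrom_prep {α : Type} [DecidableEq α] {a c d : α} (hca : c ≠ a)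
    (hda : d ≠ a) (hcd : c ≠ d) {K C : ℕ} {X : List α}
    (hX : ∀ P : List (List α), P.getLast? = some (List.replicate K a ++ [d]) →
      (∀ w ∈ adjacentPairs P, IsLzmwWord a c d (K + 1) (K + 1) K w) →
      (∀ j < K, block a d [c] 1 j ∈ adjacentPairs P) → C ≤ (lzmwFrom P (d :: X)).length)
    (P : List (List α)) (hP : ∀ p ∈ P, p ≠ [] ∧ ∀ x ∈ p, x ≠ a ∧ x ≠ c ∧ x ≠ d) :
    C ≤ (lzmwFrom P (lzmwPrep a c d K ++ d :: X)).length := by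
  obtain ⟨S, h0, hK, hS⟩ := exists_suffixes
    (fun i => c :: (List.replicate (2 * i + 1) a ++ [d])) (K + 1) (d :: X)
  have hsplit : ∀ i ≤ K, S i =
      (c :: List.replicate i a) ++ (List.replicate (i + 1) a ++ d :: S (i + 1)) := by
    intro i hi
    have e1 : 2 * i + 1 = i + (i + 1) := by omega
    rw [hS i (by omega), e1, List.replicate_add]
    simp only [List.append_assoc, List.cons_append, List.nil_append]
  have hjunk : ∀ p ∈ P, ∀ q, IsLzmwWord a c d 0 0 0 (p ++ q) := by
    intro p hp q
    obtain ⟨h1, h2⟩ := hP p hp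
    obtain ⟨x, p', rfl⟩ := List.exists_cons_of_ne_nil h1
    obtain ⟨h3, h4, h5⟩ := h2 x (by simp)
    exact Or.inr (Or.inr (Or.inr ⟨x, p' ++ q, h3, h4, h5, rfl⟩))
  have hword : ∀ w ∈ adjacentPairs P, IsLzmwWord a c d 0 0 0 w := by
    intro w hw
    obtain ⟨p, hp, q, -, rfl⟩ := exists_of_mem_adjacentPairs hw
    exact hjunk p hp q
  have hu : longestMatch (adjacentPairs P)
      ((c :: List.replicate 0 a) ++ (List.replicate (0 + 1) a ++ d :: S (0 + 1))) =
      c :: List.replicate 0 a := by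
    refine longestMatch_eq (Or.inl rfl) (by simp) (List.prefix_append _ _) fun w hw hwt => ?_
    rcases (hword w hw).prefix (i := 0) hca hda (Or.inl rfl) hwt with h | h
    · simpa using h.2
    · exact absurd h.1 hcd
  rw [lzmwPrep, ← h0, hsplit 0 (Nat.zero_le _), lzmwFrom_append (by simp) hu, List.length_cons]
  refine (le_length_lzmwFrom_prep_aux hca hda hcd (K := K) (X := X)
    (T := fun i => List.replicate (i + 1) a ++ d :: S (i + 1)) (by simp only [hK])
    (fun i hi => by simp only [hsplit (i + 1) hi, List.cons_append]) hX K 0 _ (by omega) (by simp)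
    (fun w hw => ?_) (fun j h0 hj => by omega) (fun j hj => by omega)).trans (Nat.le_succ _)
  rcases mem_adjacentPairs_concat.1 hw with hw | ⟨p, hp, rfl⟩
  · exact hword w hw
  · exact hjunk p (List.mem_of_getLast? hp) _

/-! ### The sequence of blocks -/

/-- The index of the block at the even position `2 * q`. -/
def evenIndex (k q : ℕ) : ℕ := q / (k + 1)

/-- The index of the block at the odd position `2 * q + 1`. The sum with `evenIndex k q` depends
only on the remainder of `q` modulo `k + 1`; for `q < k * (k + 1)` the subtraction is not
truncated. -/
def oddIndex (k q : ℕ) : ℕ := 3 * k + q % (k + 1) - q / (k + 1)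

theorem evenIndex_lt {k q : ℕ} (h : q < k * (k + 1)) : evenIndex k q < k :=
  Nat.div_lt_of_lt_mul (by rwa [mul_comm])

theorem oddIndex_add_evenIndex {k q : ℕ} (h : q < k * (k + 1)) :
    oddIndex k q + evenIndex k q = 3 * k + q % (k + 1) := by
  have := evenIndex_lt h
  unfold evenIndex oddIndex at *
  omega

theorem lt_oddIndex {k q : ℕ} (h : q < k * (k + 1)) : k < oddIndex k q ∧ oddIndex k q ≤ 4 * k := by
  have h1 := evenIndex_lt h
  have h2 := oddIndex_add_evenIndex h
  have h3 : q % (k + 1) < k + 1 := Nat.mod_lt q (Nat.succ_pos k)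
  omega

theorem evenIndex_succ (k q : ℕ) :
    evenIndex k (q + 1) = evenIndex k q + if q % (k + 1) = k then 1 else 0 := by
  unfold evenIndex
  rw [Nat.succ_div]
  congr 1
  refine if_congr ?_ rfl rfl
  rw [Nat.dvd_iff_mod_eq_zero, ← Nat.mod_add_mod]
  have : q % (k + 1) < k + 1 := Nat.mod_lt q (Nat.succ_pos k)
  constructor
  · intro h
    by_contra hne
    rw [Nat.mod_eq_of_lt (by omega)] at h
    omega
  · intro h
    rw [h, Nat.mod_self]

theorem eq_of_evenIndex_eq_of_oddIndex_eq {k p q : ℕ} (hp : p < k * (k + 1)) (hq : q < k * (k + 1))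
    (h1 : evenIndex k p = evenIndex k q) (h2 : oddIndex k p = oddIndex k q) : p = q := by
  have hp' := oddIndex_add_evenIndex hp
  have hq' := oddIndex_add_evenIndex hq
  have h3 : p % (k + 1) = q % (k + 1) := by omega
  rw [← Nat.div_add_mod p (k + 1), ← Nat.div_add_mod q (k + 1), h3]
  unfold evenIndex at h1
  rw [h1]

/-- The sum `oddIndex k p + evenIndex k (p + 1)` is `3 * k + r` with `r = p % (k + 1)` if `r < k`,
and `4 * k + 1` otherwise, so that it determines `r`. -/
theorem eq_of_oddIndex_eq_of_evenIndex_succ_eq {k p q : ℕ} (hp : p < k * (k + 1))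
    (hq : q < k * (k + 1)) (h1 : oddIndex k p = oddIndex k q)
    (h2 : evenIndex k (p + 1) = evenIndex k (q + 1)) : p = q := by
  have hp' := oddIndex_add_evenIndex hp
  have hq' := oddIndex_add_evenIndex hq
  have hp3 : p % (k + 1) < k + 1 := Nat.mod_lt p (Nat.succ_pos k)
  have hq3 : q % (k + 1) < k + 1 := Nat.mod_lt q (Nat.succ_pos k)
  rw [evenIndex_succ, evenIndex_succ] at h2
  refine eq_of_evenIndex_eq_of_oddIndex_eq hp hq ?_ h1
  split_ifs at h2 <;> omega

theorem evenIndex_ne_oddIndex {k p q : ℕ} (hp : p < k * (k + 1)) (hq : q < k * (k + 1)) :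
    evenIndex k p ≠ oddIndex k q :=
  ((evenIndex_lt hp).trans (lt_oddIndex hq).1).ne

/-- The period `(∏_{r ≤ k} (m a³ᵏ⁺ᵗ⁺ʳ)²) a` of the hard string, where `m = c :: m'`. -/
def hardPeriod {α : Type} (a c : α) (m' : List α) (t k : ℕ) : List α :=
  (List.range (k + 1)).flatMap (fun r =>
    c :: m' ++ List.replicate (3 * k + t + r) a ++
      (c :: m' ++ List.replicate (3 * k + t + r) a)) ++ [a]

theorem range_mul_flatMap {α : Type} (f : ℕ → List α) (n p : ℕ) :
    (List.range (n * p)).flatMap f =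
      (List.range n).flatMap fun i => (List.range p).flatMap fun r => f (i * p + r) := by
  induction n with
  | zero => simp
  | succ n ih =>
    rw [Nat.succ_mul, List.range_add, List.flatMap_append, ih, List.range_succ,
      List.flatMap_append, List.flatMap_map]
    simp

/-- The `k`-th power of the period is a concatenation of blocks: cutting it in the runs of `a`s
instead of at the markers, these runs have as lengths the sums of the indices of neighbouring
blocks. -/
theorem exists_blocks {α : Type} (a c : α) (m' : List α) (t k : ℕ) (R : List α) :
    ∃ T : ℕ → List α, T 0 = (List.range k).flatMap (fun _ => hardPeriod a c m' t k) ++ R ∧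
      ∀ q < k * (k + 1), T q = block a c m' t (evenIndex k q) ++
        (block a c m' t (oddIndex k q) ++ T (q + 1)) := by
  let f : ℕ → List α := fun q =>
    c :: m' ++ List.replicate (evenIndex k q + t + oddIndex k q) a ++
      (c :: m' ++ List.replicate (oddIndex k q + t + evenIndex k (q + 1)) a)
  obtain ⟨S, h0, -, hS⟩ := exists_suffixes f (k * (k + 1)) R
  refine ⟨fun q => List.replicate (evenIndex k q) a ++ S q, ?_, fun q hq => ?_⟩
  · have hf : ∀ i ∈ List.range k, ((List.range (k + 1)).flatMap fun r => f (i * (k + 1) + r)) =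
        hardPeriod a c m' t k := by
      intro i hi
      rw [List.mem_range] at hi
      have hlt : ∀ r ≤ k, i * (k + 1) + r < k * (k + 1) := by
        intro r hr
        calc i * (k + 1) + r < i * (k + 1) + (k + 1) := by omega
          _ = (i + 1) * (k + 1) := by ring
          _ ≤ k * (k + 1) := Nat.mul_le_mul_right _ hi
      have hmod : ∀ r ≤ k, (i * (k + 1) + r) % (k + 1) = r := by
        intro r hr
        rw [mul_comm, Nat.mul_add_mod]
        exact Nat.mod_eq_of_lt (by omega)
      have hfr : ∀ r ≤ k, f (i * (k + 1) + r) = (c :: m' ++ List.replicate (3 * k + t + r) a ++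
          (c :: m' ++ List.replicate (3 * k + t + r) a)) ++ if r = k then [a] else [] := by
        intro r hr
        have h1 := oddIndex_add_evenIndex (hlt r hr)
        have h2 := evenIndex_succ k (i * (k + 1) + r)
        rw [hmod r hr] at h1 h2
        have e1 : evenIndex k (i * (k + 1) + r) + t + oddIndex k (i * (k + 1) + r) =
          3 * k + t + r := by omega
        have e2 : oddIndex k (i * (k + 1) + r) + t + evenIndex k (i * (k + 1) + r + 1) =
          (3 * k + t + r) + if r = k then 1 else 0 := by omega
        simp only [f, e1, e2, List.replicate_add _ (if r = k then 1 else 0)]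
        split_ifs <;> simp only [List.append_assoc, List.replicate_one, List.replicate_zero]
      have hrange : (List.range k).flatMap (fun r => f (i * (k + 1) + r)) =
          (List.range k).flatMap fun r => c :: m' ++ List.replicate (3 * k + t + r) a ++
            (c :: m' ++ List.replicate (3 * k + t + r) a) := by
        refine List.flatMap_congr fun r hr => ?_
        rw [List.mem_range] at hr
        rw [hfr r hr.le, if_neg hr.ne, List.append_nil]
      rw [hardPeriod, List.range_succ, List.flatMap_append, List.flatMap_append, hrange]
      simp only [List.flatMap_singleton, hfr k le_rfl, if_true, List.append_assoc]
    have hz : evenIndex k 0 = 0 := Nat.zero_div _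
    simp only [h0, hz, List.replicate_zero, List.nil_append, range_mul_flatMap]
    rw [List.flatMap_congr hf]
  · simp only [hS q hq, f, block, List.replicate_add, List.append_assoc, List.cons_append]

theorem le_length_lzdParsing {α : Type} [DecidableEq α] {a b : α} (hb : b ≠ a) (k : ℕ)
    (R : List α) :
    k ^ 2 ≤ (lzdParsing (lzdPrep a b (4 * k) ++
      ((List.range k).flatMap (fun _ => hardPeriod a b [] 0 k) ++ R))).length := by
  rcases Nat.eq_zero_or_pos k with rfl | hk
  · simp
  refine le_length_lzdFrom_prep hb fun P hword hmem => ?_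
  obtain ⟨T, h0, hT⟩ := exists_blocks a b [] 0 k R
  have hblock : ∀ j ≤ 4 * k, (block a b [] 0 j).length = 1 ∨ block a b [] 0 j ∈ P := by
    intro j hj
    rcases Nat.eq_zero_or_pos j with rfl | h
    · exact Or.inl rfl
    · exact Or.inr (hmem j h hj)
  rw [← h0]
  refine le_length_lzdFrom_blocks hb hT
    (fun p hp q hq => eq_of_evenIndex_eq_of_oddIndex_eq hp hq)
    (fun p hp q hq => evenIndex_ne_oddIndex hp hq) (k ^ 2) 0 P (by nlinarith)
    (fun p hp => ⟨hblock _ ?_, hblock _ (lt_oddIndex hp).2⟩) fun w hw j hj => Or.inl ?_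
  · have := evenIndex_lt hp
    omega
  · obtain ⟨i, hi⟩ := hword w hw
    obtain ⟨e, he, rfl⟩ := hi.exists_eq
    obtain ⟨rfl, -⟩ := replicate_append_cons_prefix hb hb hj
    simp [block]
    omega

theorem le_length_lzmwFrom {α : Type} [DecidableEq α] {a c d : α} (hca : c ≠ a) (hda : d ≠ a)
    (hcd : c ≠ d) {k : ℕ} (R : List α) (P : List (List α))
    (hP : ∀ p ∈ P, p ≠ [] ∧ ∀ x ∈ p, x ≠ a ∧ x ≠ c ∧ x ≠ d) :
    k ^ 2 ≤ (lzmwFrom P (lzmwPrep a c d (4 * k + 1) ++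
      ((List.range k).flatMap (fun _ => hardPeriod a d [c] 1 k) ++ R))).length := by
  rcases Nat.eq_zero_or_pos k with rfl | hk
  · simp
  obtain ⟨T, h0, hT⟩ := exists_blocks a d [c] 1 k R
  have hn : 0 < k * (k + 1) := by positivity
  have hz : evenIndex k 0 = 0 := Nat.zero_div _
  have hx : ∀ p < k * (k + 1), evenIndex k p < 4 * k + 1 := fun p hp => by
    have := evenIndex_lt hp
    omega
  have hy : ∀ p < k * (k + 1), oddIndex k p < 4 * k + 1 := fun p hp =>
    Nat.lt_succ_of_le (lt_oddIndex hp).2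
  obtain ⟨X, hX⟩ : ∃ X, T 0 = d :: X := ⟨_, by rw [hT 0 hn, hz, block]; rfl⟩
  rw [← h0, hX]
  refine le_length_lzmwFrom_prep hca hda hcd (fun Q hlast hword hmem => ?_) P hP
  have hD : DictBound a d [c] 1 (adjacentPairs Q) fun _ _ => False :=
    fun w hw j hj => Or.inl ((hword w hw).length_le hca hda hcd hj)
  have hu := longestMatch_block hda hD (Or.inr (hmem _ (hx 0 hn)))
    (y := oddIndex k 0) id (T (0 + 1))
  rw [← hX, hT 0 hn, lzmwFrom_append block_ne_nil hu, List.length_cons]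
  refine le_trans (le_length_lzmwFrom_blocks hda hT
    (fun p hp q hq => eq_of_evenIndex_eq_of_oddIndex_eq hp hq)
    (fun p hp q hq => eq_of_oddIndex_eq_of_evenIndex_succ_eq hp hq)
    (fun p hp q hq => evenIndex_ne_oddIndex hp hq) (k ^ 2) 0
    (Q ++ [block a d [c] 1 (evenIndex k 0)]) (by nlinarith) (by simp)
    (fun p hp => ⟨mem_adjacentPairs_concat.2 (Or.inl (hmem _ (hx p hp))),
      mem_adjacentPairs_concat.2 (Or.inl (hmem _ (hy p hp)))⟩) fun w hw j hj => Or.inl ?_)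
    (Nat.le_succ _)
  rcases mem_adjacentPairs_concat.1 hw with hw | ⟨p, hp, rfl⟩
  · exact (hword w hw).length_le hca hda hcd hj
  · -- The pair formed at the border starts with `aⁱ d d` and hence not with a marker `d c`.
    rw [hlast, Option.some_inj] at hp
    rw [← hp, hz, block, List.append_assoc] at hj
    have := (replicate_append_cons_prefix hda hda hj).2.2
    simp [hcd] at this

/-! ### The hard string and its grammars -/

/-- The hard string: one part for the LZD parsing and, over other letters, one for the LZMW parsing,
each consisting of a preparation and a power of a period. -/
def hardString (k : ℕ) : List (Fin 6) :=
  lzdPrep 0 1 (4 * k) ++ ((List.range k).flatMap (fun _ => hardPeriod 0 1 [] 0 k) ++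
    (lzmwPrep 2 3 4 (4 * k + 1) ++
      ((List.range k).flatMap (fun _ => hardPeriod 2 4 [3] 1 k) ++ [5])))

theorem mem_lzdPrep {α : Type} {a b : α} {K : ℕ} {x : α} (h : x ∈ lzdPrep a b K) :
    x = a ∨ x = b := by
  simp only [lzdPrep, lzdPiece, List.mem_append, List.mem_flatMap, List.mem_cons,
    List.mem_replicate] at h
  tauto

theorem mem_hardPeriod {α : Type} {a c : α} {m' : List α} {t k : ℕ} {x : α}
    (h : x ∈ hardPeriod a c m' t k) : x = a ∨ x = c ∨ x ∈ m' := by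
  simp only [hardPeriod, List.mem_append, List.mem_flatMap, List.mem_cons,
    List.mem_replicate, List.not_mem_nil] at h
  tauto

theorem mem_lzmwPrep {α : Type} {a c d : α} {K : ℕ} {x : α} (h : x ∈ lzmwPrep a c d K) :
    x = a ∨ x = c ∨ x = d := by
  simp only [lzmwPrep, List.mem_append, List.mem_flatMap, List.mem_cons,
    List.mem_replicate, List.not_mem_nil] at h
  tauto

theorem exists_hardString_eq (k : ℕ) : ∃ (t : List (Fin 6)) (d : Fin 6),
    hardString k = t ++ [d] ∧ d ∉ t := by
  refine ⟨lzdPrep 0 1 (4 * k) ++ ((List.range k).flatMap (fun _ => hardPeriod 0 1 [] 0 k) ++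
    (lzmwPrep 2 3 4 (4 * k + 1) ++ (List.range k).flatMap (fun _ => hardPeriod 2 4 [3] 1 k))), 5,
    by simp only [hardString, List.append_assoc], ?_⟩
  simp only [List.mem_append, List.mem_flatMap]
  rintro (h | ⟨_, _, h⟩ | h | ⟨_, _, h⟩)
  · exact absurd (mem_lzdPrep h) (by decide)
  · exact absurd (mem_hardPeriod h) (by decide)
  · exact absurd (mem_lzmwPrep h) (by decide)
  · exact absurd (mem_hardPeriod h) (by decide)

theorem length_output_le_size {α : Type} (g : ContextFreeGrammar α)
    {r : ContextFreeRule α g.NT} (hr : r ∈ g.rules) : r.output.length ≤ g.size :=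
  Finset.single_le_sum (f := fun r : ContextFreeRule α g.NT => r.output.length)
    (fun _ _ => Nat.zero_le _) hr

theorem length_lzdParsing_le_size {α : Type} [DecidableEq α] (s : List α) :
    (lzdParsing s).length ≤ (lzdGrammar s).size := by
  let r : ContextFreeRule α (Option ℕ) :=
    ⟨none, (List.range (lzdParsing s).length).map fun i => Symbol.nonterminal (some i)⟩
  have hr : r.output.length = (lzdParsing s).length := by simp [r]
  have hmem : r ∈ (lzdGrammar s).rules := by
    unfold lzdGrammar
    exact Finset.mem_insert_self _ _
  exact hr ▸ length_output_le_size (lzdGrammar s) hmem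

theorem length_lzmwParsing_le_size {α : Type} [DecidableEq α] (s : List α) :
    (lzmwParsing s).length ≤ (lzmwGrammar s).size := by
  let r : ContextFreeRule α (Option ℕ) :=
    ⟨none, (List.range (lzmwParsing s).length).map fun i => Symbol.nonterminal (some i)⟩
  have hr : r.output.length = (lzmwParsing s).length := by simp [r]
  have hmem : r ∈ (lzmwGrammar s).rules := by
    unfold lzmwGrammar
    exact Finset.mem_insert_self _ _
  exact hr ▸ length_output_le_size (lzmwGrammar s) hmem

theorem sq_le_size_lzdGrammar (k : ℕ) : k ^ 2 ≤ (lzdGrammar (hardString k)).size :=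
  (le_length_lzdParsing (by decide) k _).trans (length_lzdParsing_le_size _)

theorem sq_le_size_lzmwGrammar (k : ℕ) : k ^ 2 ≤ (lzmwGrammar (hardString k)).size := by
  refine le_trans ?_ (length_lzmwParsing_le_size _)
  rw [lzmwParsing, hardString, ← List.append_assoc]
  refine le_length_lzmwFrom_append (L := fun x => x = 0 ∨ x = 1) (fun y hy => ?_)
    (fun P hP => ?_) _ _ rfl (fun x hx => ?_) [] (by simp)
  · simp only [List.mem_append, List.mem_flatMap, List.mem_singleton] at hy
    rcases hy with h | ⟨_, _, h⟩ | rfl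
    · rcases mem_lzmwPrep h with rfl | rfl | rfl <;> decide
    · rcases mem_hardPeriod h with rfl | rfl | h
      · decide
      · decide
      · rw [List.mem_singleton.1 h]
        decide
    · decide
  · refine le_length_lzmwFrom (by decide) (by decide) (by decide) [5] P fun p hp =>
      ⟨(hP p hp).1, fun x hx => ?_⟩
    rcases (hP p hp).2 x hx with rfl | rfl <;> decide
  · simp only [List.mem_append, List.mem_flatMap] at hx
    rcases hx with h | ⟨_, _, h⟩
    · exact mem_lzdPrep h
    · simpa using mem_hardPeriod h

theorem length_flatMap_range_le {α : Type} (f : ℕ → List α) (n B : ℕ)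
    (h : ∀ i < n, (f i).length ≤ B) : ((List.range n).flatMap f).length ≤ n * B := by
  induction n with
  | zero => simp
  | succ n ih =>
    rw [List.range_succ, List.flatMap_append, List.length_append, List.flatMap_singleton,
      Nat.succ_mul]
    exact Nat.add_le_add (ih fun i hi => h i (by omega)) (h n (by omega))

theorem length_hardPeriod_le {α : Type} (a c : α) (m' : List α) (t k : ℕ) :
    (hardPeriod a c m' t k).length ≤ (k + 1) * (2 * (1 + m'.length + (4 * k + t))) + 1 := by
  rw [hardPeriod, List.length_append, List.length_singleton]
  refine Nat.add_le_add_right (length_flatMap_range_le _ _ _ fun r hr => ?_) 1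
  simp
  omega

theorem length_hardString_le {k : ℕ} (hk : 0 < k) : (hardString k).length ≤ 1000 * k ^ 3 := by
  have h1 : (lzdPrep (0 : Fin 6) 1 (4 * k)).length ≤ 4 * k * (16 * k + 5) + (8 * k + 2) := by
    rw [lzdPrep, List.length_append]
    refine Nat.add_le_add (length_flatMap_range_le _ _ _ fun j hj => ?_) ?_
    · simp [lzdPiece]
      omega
    · simp
      omega
  have h2 : ((List.range k).flatMap (fun _ => hardPeriod (0 : Fin 6) 1 [] 0 k)).length ≤
      k * ((k + 1) * (2 * (1 + 0 + (4 * k + 0))) + 1) :=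
    length_flatMap_range_le _ _ _ fun _ _ => length_hardPeriod_le ..
  have h3 : (lzmwPrep (2 : Fin 6) 3 4 (4 * k + 1)).length ≤ (4 * k + 1 + 1) * (8 * k + 5) := by
    refine length_flatMap_range_le _ _ _ fun j hj => ?_
    simp
    omega
  have h4 : ((List.range k).flatMap (fun _ => hardPeriod (2 : Fin 6) 4 [3] 1 k)).length ≤
      k * ((k + 1) * (2 * (1 + 1 + (4 * k + 1))) + 1) :=
    length_flatMap_range_le _ _ _ fun _ _ => length_hardPeriod_le ..
  have e1 : k ≤ k ^ 3 := Nat.le_self_pow (by norm_num) k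
  have e2 : k ^ 2 ≤ k ^ 3 := Nat.pow_le_pow_right hk (by norm_num)
  have e3 : 1 ≤ k ^ 3 := Nat.one_le_pow _ _ hk
  simp only [hardString, List.length_append, List.length_singleton]
  ring_nf at *
  omega

/-- The nonterminals of a small grammar of the hard string: the start symbol, the two periods, and
the powers of the two letters that form the runs. -/
inductive HardNT
  | start
  | period (e : Bool)
  | power (e : Bool) (j : ℕ)

/-- The letter that forms the runs of the two parts of the hard string. -/
def runLetter (e : Bool) : Fin 6 := if e then 2 else 0

/-- The string denoted by a nonterminal. -/
def HardNT.value (k : ℕ) : HardNT → List (Fin 6)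
  | .start => hardString k
  | .period false => hardPeriod 0 1 [] 0 k
  | .period true => hardPeriod 2 4 [3] 1 k
  | .power e j => List.replicate j (runLetter e)

/-- The rank of a nonterminal; the right-hand sides of its rules have nonterminals of smaller rank
only. -/
def HardNT.rank (k : ℕ) : HardNT → ℕ
  | .start => 8 * k + 5
  | .period _ => 8 * k + 4
  | .power _ j => j

open Symbol in
/-- The right-hand sides of the rules. -/
def HardNT.rhs (k : ℕ) : HardNT → List (Symbol (Fin 6) HardNT)
  | .start =>
    ((List.range (4 * k)).flatMap fun j => [nonterminal (.power false (j + 1)), terminal 1,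
      nonterminal (.power false (2 * j + 1)), terminal 1, nonterminal (.power false (j + 1))]) ++
    ([nonterminal (.power false (4 * k + 1)), terminal 1, nonterminal (.power false (4 * k))] ++
    ((List.range k).flatMap (fun _ => [nonterminal (.period false)]) ++
    (((List.range (4 * k + 2)).flatMap fun i =>
      [terminal 3, nonterminal (.power true (2 * i + 1)), terminal 4]) ++
    ((List.range k).flatMap (fun _ => [nonterminal (.period true)]) ++ [terminal 5]))))
  | .period false =>
    ((List.range (k + 1)).flatMap fun r => [terminal 1, nonterminal (.power false (3 * k + r)),
      terminal 1, nonterminal (.power false (3 * k + r))]) ++ [terminal 0]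
  | .period true =>
    ((List.range (k + 1)).flatMap fun r =>
      [terminal 4, terminal 3, nonterminal (.power true (3 * k + 1 + r)),
      terminal 4, terminal 3, nonterminal (.power true (3 * k + 1 + r))]) ++ [terminal 2]
  | .power _ 0 => []
  | .power e (j + 1) => [nonterminal (.power e j), terminal (runLetter e)]

theorem HardNT.flatMap_rhs (k : ℕ) (i : HardNT) :
    (i.rhs k).flatMap (symbolValue (HardNT.value k)) = i.value k := by
  rcases i with _ | (_ | _) | ⟨e, _ | j⟩
  · simp only [rhs, value, hardString, lzdPrep, lzmwPrep, List.flatMap_append,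
      List.flatMap_assoc, List.flatMap_cons, List.flatMap_nil, symbolValue, List.append_assoc,
      List.cons_append, List.nil_append, List.append_nil]
    rfl
  · simp [rhs, value, hardPeriod, symbolValue, runLetter, List.flatMap_assoc]
  · simp [rhs, value, hardPeriod, symbolValue, runLetter, List.flatMap_assoc]
  · rfl
  · simp [rhs, value, symbolValue, List.replicate_succ']

/-- All nonterminals that are used. -/
def hardNTs (k : ℕ) : List HardNT :=
  [.start, .period false, .period true] ++ ((List.range (8 * k + 4)).map (HardNT.power false) ++
    (List.range (8 * k + 4)).map (HardNT.power true))

theorem mem_hardNTs_of_power {k : ℕ} {e : Bool} {j : ℕ} (h : j < 8 * k + 4) :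
    HardNT.power e j ∈ hardNTs k := by
  cases e <;> simp [hardNTs, h]

theorem HardNT.rank_lt {k : ℕ} {i j : HardNT} (hi : i ∈ hardNTs k)
    (h : Symbol.nonterminal j ∈ i.rhs k) : j.rank k < i.rank k ∧ j ∈ hardNTs k := by
  rcases i with _ | (_ | _) | ⟨e, _ | n⟩
  · simp only [rhs, List.mem_append, List.mem_flatMap, List.mem_cons, List.mem_range,
      Symbol.nonterminal.injEq, reduceCtorEq, List.not_mem_nil, false_or, or_false] at h
    rcases h with ⟨n, hn, rfl | rfl | rfl⟩ | (rfl | rfl) | ⟨n, hn, rfl⟩ | ⟨n, hn, rfl⟩ |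
      ⟨n, hn, rfl⟩
    all_goals first
      | exact ⟨by simp only [rank]; omega, mem_hardNTs_of_power (by omega)⟩
      | exact ⟨by simp only [rank]; omega, by simp [hardNTs]⟩
  · simp only [rhs, List.mem_append, List.mem_flatMap, List.mem_cons, List.mem_range,
      Symbol.nonterminal.injEq, reduceCtorEq, List.not_mem_nil, false_or, or_false] at h
    rcases h with ⟨n, hn, rfl | rfl⟩ <;>
      exact ⟨by simp only [rank]; omega, mem_hardNTs_of_power (by omega)⟩
  · simp only [rhs, List.mem_append, List.mem_flatMap, List.mem_cons, List.mem_range,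
      Symbol.nonterminal.injEq, reduceCtorEq, List.not_mem_nil, false_or, or_false] at h
    rcases h with ⟨n, hn, rfl | rfl⟩ <;>
      exact ⟨by simp only [rank]; omega, mem_hardNTs_of_power (by omega)⟩
  · simp [rhs] at h
  · simp only [rhs, List.mem_cons, Symbol.nonterminal.injEq, reduceCtorEq, List.not_mem_nil,
      or_false] at h
    subst h
    refine ⟨by simp only [rank]; omega, mem_hardNTs_of_power ?_⟩
    cases e <;> simp [hardNTs] at hi <;> omega

theorem smallestGrammarSize_hardString_le {k : ℕ} (hk : 0 < k) :
    smallestGrammarSize (hardString k) ≤ 114 * k := by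
  have h := smallestGrammarSize_le
    ((hardNTs k).map fun i => (⟨i, i.rhs k⟩ : ContextFreeRule (Fin 6) HardNT))
    (HardNT.value k) (HardNT.rank k) (by simp [HardNT.flatMap_rhs])
    (by
      simp only [List.mem_map, exists_exists_and_eq_and, exists_eq_right]
      rintro _ ⟨i, hi, rfl⟩ j hj
      exact HardNT.rank_lt hi hj)
    HardNT.start (by simp [hardNTs])
  refine h.trans ?_
  have hpow : ∀ e, (((List.range (8 * k + 4)).map (HardNT.power e)).map
      fun i => (i.rhs k).length).sum ≤ (8 * k + 4) * 2 := by
    intro e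
    have := List.sum_le_card_nsmul (((List.range (8 * k + 4)).map (HardNT.power e)).map
      fun i => (i.rhs k).length) 2 ?_
    · simpa using this
    · simp only [List.mem_map]
      rintro _ ⟨_, ⟨j, _, rfl⟩, rfl⟩
      cases j <;> simp [HardNT.rhs]
  have h0 : (HardNT.start.rhs k).length = 34 * k + 10 := by
    simp [HardNT.rhs]
    ring
  have h1 : ((HardNT.period false).rhs k).length = 4 * k + 5 := by
    simp [HardNT.rhs]
    ring
  have h2 : ((HardNT.period true).rhs k).length = 6 * k + 7 := by
    simp [HardNT.rhs]
    ring
  have h3 := hpow false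
  have h4 := hpow true
  simp only [hardNTs, List.map_append, List.map_map, List.sum_append, List.map_cons, List.map_nil,
    List.sum_cons, List.sum_nil, Function.comp_def, h0, h1, h2] at h3 h4 ⊢
  omega

theorem theorem1 :
    ∃ (σ : ℕ) (c : ℝ), 0 < c ∧
      ∀ N : ℕ, ∃ n : ℕ, N ≤ n ∧
        ∃ s : List (Fin σ), s.length = n ∧
          (∃ (t : List (Fin σ)) (d : Fin σ), s = t ++ [d] ∧ d ∉ t) ∧
          c * (n : ℝ) ^ ((1 : ℝ) / 3) * (smallestGrammarSize s : ℝ) ≤ ((lzdGrammar s).size : ℝ) ∧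
          c * (n : ℝ) ^ ((1 : ℝ) / 3) * (smallestGrammarSize s : ℝ) ≤ ((lzmwGrammar s).size : ℝ) := by
  -- `1140 = 10 * 114`: the cube root of the length is at most `10 * k`, and the smallest grammar has
  -- size at most `114 * k`.
  refine ⟨6, 1 / 1140, by norm_num, fun N => ?_⟩
  have hk : 0 < N + 1 := Nat.succ_pos N
  have hlen := length_hardString_le hk
  have hsmall := smallestGrammarSize_hardString_le hk
  have hlzd := sq_le_size_lzdGrammar (N + 1)
  have hlzmw := sq_le_size_lzmwGrammar (N + 1)
  have hlow : N + 1 ≤ (hardString (N + 1)).length := by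
    simp [hardString, lzdPrep]
    omega
  refine ⟨_, by omega, hardString (N + 1), rfl, exists_hardString_eq _, ?_⟩
  generalize N + 1 = k at *
  have hroot : ((hardString k).length : ℝ) ^ ((1 : ℝ) / 3) ≤ 10 * k := by
    have h1 : ((hardString k).length : ℝ) ≤ (10 * k) ^ (3 : ℝ) := by
      have : ((hardString k).length : ℝ) ≤ 1000 * (k : ℝ) ^ 3 := by exact_mod_cast hlen
      have e : (10 * (k : ℝ)) ^ (3 : ℝ) = 1000 * (k : ℝ) ^ 3 := by
        rw [show (3 : ℝ) = ((3 : ℕ) : ℝ) by norm_num, Real.rpow_natCast]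
        ring
      rw [e]
      exact this
    calc ((hardString k).length : ℝ) ^ ((1 : ℝ) / 3)
        ≤ ((10 * k) ^ (3 : ℝ)) ^ ((1 : ℝ) / 3) :=
          Real.rpow_le_rpow (by positivity) h1 (by norm_num)
      _ = 10 * k := by
          rw [← Real.rpow_mul (by positivity)]
          norm_num
  have hbound : 1 / 1140 * ((hardString k).length : ℝ) ^ ((1 : ℝ) / 3) *
      (smallestGrammarSize (hardString k) : ℝ) ≤ ((k ^ 2 : ℕ) : ℝ) := by
    have h2 : (smallestGrammarSize (hardString k) : ℝ) ≤ 114 * k := by exact_mod_cast hsmall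
    calc 1 / 1140 * ((hardString k).length : ℝ) ^ ((1 : ℝ) / 3) *
          (smallestGrammarSize (hardString k) : ℝ)
        ≤ 1 / 1140 * (10 * k) * (114 * k) := by gcongr
      _ = ((k ^ 2 : ℕ) : ℝ) := by
          push_cast
          ring
  exact ⟨hbound.trans (by exact_mod_cast hlzd), hbound.trans (by exact_mod_cast hlzmw)⟩
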